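/- Consider two servers in series under synchronous sequential service (SSS). Server $1$ executes step $1$ of an update and then passes the update to server $2$, which executes step $2$ and then delivers it to a monitor; server $1$ starts a new update, fresh (of age $0$), at the instant when server $2$ completes step $2$ of the previous one, so that processing of a new update starts only, and at once, when both servers are idle. All service times are independent, and those of server $i$ are exponential with rate $\mu_i>0$, $i=1,2$. Put $\rho=\mu_1/\mu_2$. Let $q(t)\in\{1,2\}$ be the server that is busy at time $t$, and let $x_0(t),x_1(t),x_2(t)$ be the ages of the update at the monitor, at server $1$ and at server $2$: they grow at unit rate between service completions; a completion at server $1$ resets $(x_0,x_1,x_2)$ to $(x_0,x_1,x_1)$, and a completion at server $2$ resets it to $(x_2,0,x_2)$. The initial state $q(0)$ and the initial ages $x_j(0)\in\mathbb R$ are arbitrary constants. Then $x_0(t)$ is integrable for every $t\ge 0$, and the average age at the monitor is $$\Delta_{\rm SSS}(\mu_2,\rho)=\lim_{t\to\infty}\mathbb E[x_0(t)]=\frac1{\mu_2}\left(2+\frac1\rho+\frac1{\rho(1+\rho)}\right).$$ Moreover, the Markov chain on $\{1,2\}$ with transition rates $\mu_1$ from $1$ to $2$ and $\mu_2$ from $2$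 to $1$ has exactly one stationary distribution $\pi=(\pi_1,\pi_2)$, and $\Pr(q(t)=q)\to\pi_q$ as $t\to\infty$ for $q=1,2$. With $n_{q,i}$ the number of processors that execute step $i$ in state $q$ and $\bar N_i(\rho)=\sum_q\pi_q n_{q,i}$, the power-weighted processor activity $\bar N(\rho)=\rho^\alpha\bar N_1(\rho)+\bar N_2(\rho)$ satisfies, for every real $\alpha$, $$\bar N(\rho)=\frac{\rho^\alpha+\rho}{1+\rho}.$$ -/

import Mathlib

open MeasureTheory ProbabilityTheory Filter Topology

namespace SSS

/-! Two servers in series under synchronous sequential service. Servers and processing steps are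
indexed by `Fin 2`: index `0` is server 1 / step 1 and index `1` is server 2 / step 2.
Exactly one server is busy at any time, so the discrete state `q : Fin 2` of the system is the
busy server. -/

/-- What processor `p` does in state `q`: `some i` means that it executes step `i`, and `none` that
it is idle. Server `p` only ever executes step `p`. -/
def activity (q p : Fin 2) : Option (Fin 2) :=
  if p = q then some p else none

/-- `n_{q,i}`: the number of processors that execute step `i` in state `q`. -/
def numWorking (q i : Fin 2) : ℕ :=
  (Finset.univ.filter fun p : Fin 2 => activity q p = some i).card

/-- The state entered when the busy server completes its service: server 1 hands its update to the
idle server 2; when server 2 is done, both servers are idle and server 1 starts a new update. -/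
def next (q : Fin 2) : Fin 2 :=
  if q = 0 then 1 else 0

/-- The reset of the age vector `x = (x 0, x 1, x 2)` = (age at the monitor, age of the update at
server 1, age of the update at server 2) at a service completion in state `q`. A completion at
server 1 moves its update to server 2. A completion at server 2 delivers its update to the
monitor, and a fresh update (of age zero) starts service at server 1. -/
def reset (q : Fin 2) (x : Fin 3 → ℝ) : Fin 3 → ℝ :=
  if q = 0 then ![x 0, x 1, x 1] else ![x 2, 0, x 2]

section Path

/-! One sample path. `s i k` is the duration of the `k`-th service (`k = 0, 1, 2, …`) of server
`i`, `q₀` the busy server at time `0`, `x₀` the age vector at time `0`. -/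

variable (s : Fin 2 → ℕ → ℝ) (q₀ : Fin 2) (x₀ : Fin 3 → ℝ)

/-- The discrete state after `n` service completions. -/
def stateAfter (n : ℕ) : Fin 2 :=
  next^[n] q₀

/-- The duration of the `n`-th service overall (`n = 0, 1, 2, …`). The servers alternate, so it is
service number `n / 2` of the server that is busy then. -/
def duration (n : ℕ) : ℝ :=
  s (stateAfter q₀ n) (n / 2)

/-- The time of the `n`-th service completion (time `0` for `n = 0`). -/
noncomputable def completionTime (n : ℕ) : ℝ :=
  ∑ k ∈ Finset.range n, duration s q₀ k

/-- The age vector immediately after the `n`-th service completion: all ages grow at unit rate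
between completions and are reset at a completion. -/
noncomputable def agesAfter : ℕ → Fin 3 → ℝ
  | 0 => x₀
  | n + 1 => reset (stateAfter q₀ n) fun j => agesAfter n j + duration s q₀ n

/-- The number of service completions in `[0, t]`. -/
noncomputable def numCompletions (t : ℝ) : ℕ :=
  sSup {n : ℕ | completionTime s q₀ n ≤ t}

/-- The discrete state `q(t)`. -/
noncomputable def stateAt (t : ℝ) : Fin 2 :=
  stateAfter q₀ (numCompletions s q₀ t)

/-- The age vector `x(t)`. -/
noncomputable def agesAt (t : ℝ) : Fin 3 → ℝ := fun j =>
  agesAfter s q₀ x₀ (numCompletions s q₀ t) j + (t - completionTime s q₀ (numCompletions s q₀ t))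

/-- The age at the monitor at time `t`. -/
noncomputable def monitorAge (t : ℝ) : ℝ :=
  agesAt s q₀ x₀ t 0

end Path

/-- The service times `S i k` are independent, and those of server `i` are exponential with rate
`rate i`. -/
structure IsServiceTimes {Ω : Type*} [MeasurableSpace Ω] (P : Measure Ω) (rate : Fin 2 → ℝ)
    (S : Fin 2 → ℕ → Ω → ℝ) : Prop where
  hasLaw : ∀ i k, HasLaw (S i k) (expMeasure (rate i)) P
  indep : iIndepFun (fun ik : Fin 2 × ℕ => S ik.1 ik.2) P

/-- The transition rate matrix of the discrete state: state `q` is left at rate `rate q`, for the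
state `next q`. -/
def generator (rate : Fin 2 → ℝ) : Matrix (Fin 2) (Fin 2) ℝ := fun q q' =>
  if q' = q then -rate q else if q' = next q then rate q else 0

/-- `π` is a stationary distribution of the continuous-time Markov chain with rate matrix `G`. -/
def IsStationary (G : Matrix (Fin 2) (Fin 2) ℝ) (π : Fin 2 → ℝ) : Prop :=
  (∀ q, 0 ≤ π q) ∧ ∑ q, π q = 1 ∧ Matrix.vecMul π G = 0

/-- The average number of processors that execute step `i`, under the distribution `π` of the
discrete state. -/
noncomputable def meanWorking (π : Fin 2 → ℝ) (i : Fin 2) : ℝ :=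
  ∑ q, π q * (numWorking q i : ℝ)

/-- The power-weighted processor activity. -/
noncomputable def powerWeightedActivity (π : Fin 2 → ℝ) (ρ α : ℝ) : ℝ :=
  ρ ^ α * meanWorking π 0 + meanWorking π 1

end SSS

/-! For a function `f` of the state and the ages, let `h τ q x` be the mean of `f` after time `τ`,
for the system started in state `q` with ages `x`. Conditioning on the end of the first service
shows that `h` solves a backward equation. Conversely, let `h` be any solution with `h 0 = f`. As a
service time is independent of what happened before, the forecasts of `f` at time `t` that `h`
makes at the service completions form a bounded martingale, which reaches the actual value of `f`
once a completion occurs after `t`. Hence `h t q₀ x₀` is the mean of `f` at time `t`.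

For the indicator of a state, the solution is explicit. For the age at the monitor, it is affine in
the ages: the coefficients of the ages are the probabilities that none or just one update has been
delivered, and they solve a cascade of equations `y' = c (g - y)`, in which `y` inherits the limit
of `g`. The mean of the constant terms under the stationary distribution is, up to a constant, a
linear combination of these probabilities, so that it tends to that constant, and the difference of
the constant terms solves one more equation of this kind, whose limit is zero. -/

namespace SSS

section Relaxation

/-- The solution `y` of the relaxation equation `y' = c (g - y)` with `y 0 = y₀`. For `c > 0`,
`relaxation c y₀ g t` is the mean of `y₀` if an exponential clock of rate `c` rings after time `t`,
and of `g (t - u)` if it rings at time `u ≤ t`. -/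
noncomputable def relaxation (c y₀ : ℝ) (g : ℝ → ℝ) (t : ℝ) : ℝ :=
  Real.exp (-(c * t)) * (y₀ + ∫ s in (0 : ℝ)..t, c * Real.exp (c * s) * g s)

variable {c y₀ L : ℝ} {g : ℝ → ℝ}

@[simp]
theorem relaxation_zero : relaxation c y₀ g 0 = y₀ := by
  simp [relaxation]

theorem relaxation_neg (t : ℝ) : relaxation c (-y₀) (fun s => -g s) t = -relaxation c y₀ g t := by
  simp only [relaxation, mul_neg, intervalIntegral.integral_neg]
  ring

theorem hasDerivAt_relaxation (hg : Continuous g) (t : ℝ) :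
    HasDerivAt (relaxation c y₀ g) (c * (g t - relaxation c y₀ g t)) t := by
  have hexp : HasDerivAt (fun t : ℝ => Real.exp (-(c * t))) (Real.exp (-(c * t)) * -(c * 1)) t :=
    ((hasDerivAt_id t).const_mul c).neg.exp
  have hforcing : Continuous fun s => c * Real.exp (c * s) * g s := by fun_prop
  have hint := (hforcing.integral_hasStrictDerivAt 0 t).hasDerivAt.const_add y₀
  refine (hexp.mul hint).congr_deriv ?_
  have hcancel : Real.exp (-(c * t)) * Real.exp (c * t) = 1 := by
    rw [← Real.exp_add, neg_add_cancel, Real.exp_zero]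
  rw [relaxation]
  linear_combination c * g t * hcancel

@[fun_prop]
theorem continuous_relaxation (hg : Continuous g) : Continuous (relaxation c y₀ g) :=
  continuous_iff_continuousAt.2 fun t => (hasDerivAt_relaxation hg t).continuousAt

theorem tendsto_exp_neg_mul_atTop (hc : 0 < c) :
    Tendsto (fun t => Real.exp (-(c * t))) atTop (𝓝 0) :=
  Real.tendsto_exp_neg_atTop_nhds_zero.comp (tendsto_id.const_mul_atTop hc)

theorem eventually_relaxation_lt (hc : 0 < c) (hg : Continuous g) (hgL : ∀ᶠ t in atTop, g t ≤ L)
    {M : ℝ} (hLM : L < M) : ∀ᶠ t in atTop, relaxation c y₀ g t < M := by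
  obtain ⟨T, hT⟩ := eventually_atTop.1 hgL
  set excess : ℝ → ℝ := fun t => Real.exp (c * t) * (relaxation c y₀ g t - L) with hexcess
  have hderiv (t : ℝ) : HasDerivAt excess (c * Real.exp (c * t) * (g t - L)) t :=
    ((((hasDerivAt_id t).const_mul c).exp).mul
      ((hasDerivAt_relaxation hg t).sub_const L)).congr_deriv (by simp only [id_eq]; ring)
  have hanti : AntitoneOn excess (Set.Ici T) := by
    refine antitoneOn_of_deriv_nonpos (convex_Ici T)
      (fun t _ => (hderiv t).continuousAt.continuousWithinAt)
      (fun t _ => (hderiv t).differentiableAt.differentiableWithinAt) fun t ht => ?_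
    rw [(hderiv t).deriv]
    exact mul_nonpos_of_nonneg_of_nonpos (by positivity) (sub_nonpos.2 (hT t (interior_subset ht)))
  have hbound : Tendsto (fun t => L + Real.exp (-(c * t)) * excess T) atTop (𝓝 L) := by
    simpa using ((tendsto_exp_neg_mul_atTop hc).mul_const (excess T)).const_add L
  filter_upwards [hbound.eventually_lt_const hLM, eventually_ge_atTop T] with t hlt hTt
  calc relaxation c y₀ g t = L + Real.exp (-(c * t)) * excess t := by
        rw [hexcess, ← mul_assoc, ← Real.exp_add, neg_add_cancel, Real.exp_zero]
        ring
    _ ≤ L + Real.exp (-(c * t)) * excess T := by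
        gcongr
        exact hanti Set.self_mem_Ici hTt hTt
    _ < M := hlt

theorem tendsto_relaxation (hc : 0 < c) (hg : Continuous g) (hgL : Tendsto g atTop (𝓝 L)) :
    Tendsto (relaxation c y₀ g) atTop (𝓝 L) := by
  refine tendsto_order.2 ⟨fun M hM => ?_, fun M hM => ?_⟩
  · obtain ⟨K, hMK, hKL⟩ := exists_between hM
    have hneg := eventually_relaxation_lt (y₀ := -y₀) hc hg.neg
      ((hgL.eventually_const_lt hKL).mono fun t ht => neg_le_neg ht.le) (neg_lt_neg hMK)
    exact hneg.mono fun t ht => neg_lt_neg_iff.1 (relaxation_neg t ▸ ht)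
  · obtain ⟨K, hLK, hKM⟩ := exists_between hM
    exact eventually_relaxation_lt hc hg ((hgL.eventually_lt_const hLK).mono fun t => le_of_lt) hKM

end Relaxation

section ExponentialLaw

variable {r : ℝ}

theorem expMeasure_real_Ioi (hr : 0 < r) {x : ℝ} (hx : 0 ≤ x) :
    (expMeasure r).real (Set.Ioi x) = Real.exp (-(r * x)) := by
  have := isProbabilityMeasure_expMeasure hr
  rw [← Set.compl_Iic, probReal_compl_eq_one_sub measurableSet_Iic, ← cdf_eq_real,
    cdf_expMeasure_eq hr, if_pos hx, sub_sub_cancel]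

theorem ae_pos_expMeasure (hr : 0 < r) : ∀ᵐ u ∂expMeasure r, 0 < u := by
  have := isProbabilityMeasure_expMeasure hr
  have hone : (expMeasure r).real (Set.Ioi 0) = 1 := by simp [expMeasure_real_Ioi hr le_rfl]
  exact (mem_ae_iff_prob_eq_one measurableSet_Ioi).2
    ((ENNReal.toReal_eq_one_iff _).1 hone)

theorem Iic_ae_eq_Ioc_expMeasure (hr : 0 < r) (τ : ℝ) :
    (Set.Iic τ : Set ℝ) =ᵐ[expMeasure r] Set.Ioc 0 τ := by
  filter_upwards [ae_pos_expMeasure hr] with u hu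
  exact propext (and_iff_right hu).symm

theorem integrableOn_Iic_expMeasure (hr : 0 < r) {φ : ℝ → ℝ} (hφ : Continuous φ) (τ : ℝ) :
    IntegrableOn φ (Set.Iic τ) (expMeasure r) := by
  have := isProbabilityMeasure_expMeasure hr
  exact (hφ.integrableOn_Ioc (a := 0)).congr_set_ae (Iic_ae_eq_Ioc_expMeasure hr τ)

theorem setIntegral_Iic_expMeasure (hr : 0 < r) (φ : ℝ → ℝ) {τ : ℝ} (hτ : 0 ≤ τ) :
    ∫ u in Set.Iic τ, φ u ∂expMeasure r =
      ∫ u in (0 : ℝ)..τ, r * Real.exp (-(r * u)) * φ u := by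
  have hdensity : expMeasure r = volume.withDensity (exponentialPDF r) := rfl
  rw [setIntegral_congr_set (Iic_ae_eq_Ioc_expMeasure hr τ), intervalIntegral.integral_of_le hτ,
    hdensity, setIntegral_withDensity_eq_setIntegral_toReal_smul
      (f := exponentialPDF r) (measurable_exponentialPDFReal r).ennreal_ofReal
      (Eventually.of_forall fun _ => ENNReal.ofReal_lt_top) _ measurableSet_Ioc]
  refine setIntegral_congr_fun measurableSet_Ioc fun u hu => ?_
  have hpdf : 0 ≤ r * Real.exp (-(r * u)) := by positivity
  simp only [exponentialPDF_of_nonneg hu.1.le, ENNReal.toReal_ofReal hpdf, smul_eq_mul]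

theorem integral_ite_lt_expMeasure (hr : 0 < r) {τ : ℝ} (hτ : 0 ≤ τ) {φ y : ℝ → ℝ}
    (hφ : Continuous φ) (hy : ∀ u, HasDerivAt y (r * (y u - φ u)) u) :
    ∫ u, (if τ < u then y τ else φ u) ∂expMeasure r = y 0 := by
  have := isProbabilityMeasure_expMeasure hr
  have hpiecewise : (fun u => if τ < u then y τ else φ u) =
      (Set.Ioi τ).piecewise (fun _ => y τ) φ := by
    ext u
    simp [Set.piecewise]
  have hprimitive (u : ℝ) : HasDerivAt (fun u => -Real.exp (-(r * u)) * y u)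
      (r * Real.exp (-(r * u)) * φ u) u :=
    (hasDerivAt_neg_exp_mul_exp.mul (hy u)).congr_deriv (by ring)
  have hcont : Continuous fun u => r * Real.exp (-(r * u)) * φ u := by fun_prop
  rw [hpiecewise, integral_piecewise measurableSet_Ioi (integrable_const _).integrableOn
    (by simpa only [Set.compl_Ioi] using integrableOn_Iic_expMeasure hr hφ τ), Set.compl_Ioi,
    setIntegral_const, expMeasure_real_Ioi hr hτ, setIntegral_Iic_expMeasure hr φ hτ,
    intervalIntegral.integral_eq_sub_of_hasDerivAt (fun u _ => hprimitive u)
      (hcont.intervalIntegrable 0 τ)]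
  simp

end ExponentialLaw

section IndependentSequences

variable {Ω : Type*} [MeasurableSpace Ω] {P : Measure Ω}

theorem ae_frequently_lt_of_iIndepFun {X : ℕ → Ω → ℝ} (hX : iIndepFun X P)
    (hXm : ∀ n, AEMeasurable (X n) P) {a : ℝ} (hsum : ∑' n, P {ω | a < X n ω} = ⊤) :
    ∀ᵐ ω ∂P, ∃ᶠ n in atTop, a < X n ω := by
  have := hX.isProbabilityMeasure
  let Y (n : ℕ) : Ω → ℝ := (hXm n).mk (X n)
  have hXY (n : ℕ) : X n =ᵐ[P] Y n := (hXm n).ae_eq_mk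
  let A (n : ℕ) : Set Ω := {ω | a < Y n ω}
  have hA (n : ℕ) : MeasurableSet (A n) :=
    measurableSet_lt measurable_const (hXm n).measurable_mk
  have hindep : iIndepSet A P := (iIndepSet_iff_meas_biInter hA).2 fun s =>
    (hX.congr hXY).meas_biInter fun _ _ => ⟨Set.Ioi a, measurableSet_Ioi, rfl⟩
  have hAsum : ∑' n, P (A n) = ⊤ := by
    rw [← hsum]
    refine tsum_congr fun n => measure_congr ?_
    filter_upwards [hXY n] with ω hω
    exact congrArg (a < ·) hω.symm
  have hlimsup : limsup A atTop ∈ ae P :=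
    (mem_ae_iff_prob_eq_one (MeasurableSet.measurableSet_limsup hA)).2
      (measure_limsup_eq_one hA hindep hAsum)
  filter_upwards [hlimsup, ae_all_iff.2 hXY] with ω hω hωXY
  simpa only [hωXY, A] using! mem_limsup_iff_frequently_mem.1 hω

theorem tendsto_sum_atTop_of_frequently_lt {x : ℕ → ℝ} (hx : ∀ n, 0 ≤ x n) {a : ℝ} (ha : 0 < a)
    (hfreq : ∃ᶠ n in atTop, a < x n) :
    Tendsto (fun n => ∑ k ∈ Finset.range n, x k) atTop atTop := by
  refine (not_summable_iff_tendsto_nat_atTop_of_nonneg hx).1 fun hsummable => hfreq ?_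
  exact (hsummable.tendsto_atTop_zero.eventually_lt_const ha).mono fun n hn => hn.not_gt

variable {α β : Type*} [MeasurableSpace α] [MeasurableSpace β] {g : ℕ → β × α → β}

theorem exists_measurable_history (hg : ∀ n, Measurable (g n)) (z₀ : β) (n : ℕ) :
    ∃ G : (Finset.range n → α) → β, Measurable G ∧
      ∀ (d : ℕ → α) (z : ℕ → β), z 0 = z₀ → (∀ k, z (k + 1) = g k (z k, d k)) →
        z n = G fun i => d i := by
  induction n with
  | zero => exact ⟨fun _ => z₀, measurable_const, fun d z hz₀ _ => hz₀⟩
  | succ n ih =>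
    obtain ⟨G, hG, hz⟩ := ih
    refine ⟨fun v => g n (G fun i => v ⟨i, Finset.range_subset_range.2 n.le_succ i.2⟩,
      v ⟨n, Finset.self_mem_range_succ n⟩), (hg n).comp (by fun_prop), fun d z hz₀ hsucc => ?_⟩
    rw [hsucc, hz d z hz₀ hsucc]

variable {D : ℕ → Ω → α} {Z : ℕ → Ω → β} {z₀ : β}

theorem aemeasurable_of_recursion (hD : ∀ n, AEMeasurable (D n) P) (hg : ∀ n, Measurable (g n))
    (hZ₀ : ∀ ω, Z 0 ω = z₀) (hZ : ∀ n ω, Z (n + 1) ω = g n (Z n ω, D n ω)) (n : ℕ) :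
    AEMeasurable (Z n) P := by
  induction n with
  | zero => exact (funext hZ₀ : Z 0 = fun _ => z₀) ▸ aemeasurable_const
  | succ n ih =>
    rw [funext (hZ n)]
    exact (hg n).comp_aemeasurable (ih.prodMk (hD n))

theorem indepFun_of_recursion (hD : iIndepFun D P) (hDm : ∀ n, AEMeasurable (D n) P)
    (hg : ∀ n, Measurable (g n)) (hZ₀ : ∀ ω, Z 0 ω = z₀)
    (hZ : ∀ n ω, Z (n + 1) ω = g n (Z n ω, D n ω)) (n : ℕ) :
    IndepFun (Z n) (D n) P := by
  obtain ⟨G, hG, hGZ⟩ := exists_measurable_history hg z₀ n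
  have hZG : Z n = G ∘ fun ω (i : Finset.range n) => D i ω :=
    funext fun ω => hGZ (D · ω) (Z · ω) (hZ₀ ω) (hZ · ω)
  rw [hZG]
  exact (hD.indepFun_finset₀ (Finset.range n) {n} (by simp) hDm).comp hG
    (measurable_pi_apply ⟨n, Finset.mem_singleton_self n⟩)

theorem integral_eq_zero_of_indepFun {U : Ω → β} {V : Ω → α} (hUV : IndepFun U V P)
    (hU : AEMeasurable U P) (hV : AEMeasurable V P) [IsFiniteMeasure P] {K : β × α → ℝ}
    (hK : Measurable K) (hint : Integrable (fun ω => K (U ω, V ω)) P)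
    (hzero : ∀ u, ∫ v, K (u, v) ∂P.map V = 0) :
    ∫ ω, K (U ω, V ω) ∂P = 0 := by
  have hmap := hUV.map_prod_eq_prod_map_map hU hV
  have hUVm := hU.prodMk hV
  have hK_int : Integrable K ((P.map U).prod (P.map V)) := by
    rwa [← hmap, integrable_map_measure hK.aestronglyMeasurable hUVm]
  rw [← integral_map hUVm hK.aestronglyMeasurable, hmap, integral_prod K hK_int]
  simp only [hzero, integral_zero]

end IndependentSequences

theorem eq_zero_or_eq_one (q : Fin 2) : q = 0 ∨ q = 1 := by
  lia

theorem next_ne (q : Fin 2) : next q ≠ q := by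
  revert q
  decide

theorem stateAfter_succ (q₀ : Fin 2) (n : ℕ) : stateAfter q₀ (n + 1) = next (stateAfter q₀ n) :=
  Function.iterate_succ_apply' _ _ _

theorem stateAfter_eq_ite (q₀ : Fin 2) (n : ℕ) :
    stateAfter q₀ n = if Even n then q₀ else next q₀ := by
  have hinv : Function.Involutive next := fun q => by revert q; decide
  split_ifs with hn
  · rw [stateAfter, hinv.iterate_even hn, id]
  · rw [stateAfter, hinv.iterate_odd (Nat.not_even_iff_odd.1 hn)]

theorem injective_stateAfter_div_two (q₀ : Fin 2) :
    Function.Injective fun n : ℕ => (stateAfter q₀ n, n / 2) := by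
  intro n m hnm
  obtain ⟨hstate, hdiv⟩ := Prod.mk.inj hnm
  have hparity : Even n ↔ Even m := by
    rw [stateAfter_eq_ite, stateAfter_eq_ite] at hstate
    split_ifs at hstate with hn hm hm
    · exact iff_of_true hn hm
    · exact absurd hstate.symm (next_ne q₀)
    · exact absurd hstate (next_ne q₀)
    · exact iff_of_false hn hm
  rw [Nat.even_iff, Nat.even_iff] at hparity
  lia

theorem continuous_reset (q : Fin 2) : Continuous (reset q) := by
  obtain rfl | rfl := eq_zero_or_eq_one q
  · exact continuous_pi fun j => by fin_cases j <;> exact continuous_apply _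
  · exact continuous_pi fun j => by
      fin_cases j <;> first | exact continuous_apply _ | exact continuous_const

theorem norm_reset_le (q : Fin 2) (x : Fin 3 → ℝ) : ‖reset q x‖ ≤ ‖x‖ := by
  refine (pi_norm_le_iff_of_nonneg (norm_nonneg x)).2 fun j => ?_
  obtain rfl | rfl := eq_zero_or_eq_one q <;> fin_cases j <;>
    first | exact norm_le_pi_norm x _ | exact norm_zero.trans_le (norm_nonneg x)

theorem norm_add_const_le (x : Fin 3 → ℝ) {u : ℝ} (hu : 0 ≤ u) : ‖fun j => x j + u‖ ≤ ‖x‖ + u := by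
  simpa only [Pi.add_def, pi_norm_const, Real.norm_of_nonneg hu] using norm_add_le x fun _ => u

section Paths

variable {s : Fin 2 → ℕ → ℝ} {q₀ : Fin 2} {x₀ : Fin 3 → ℝ} {t : ℝ} {n : ℕ}

@[simp]
theorem completionTime_zero : completionTime s q₀ 0 = 0 :=
  Finset.sum_range_zero _

theorem completionTime_succ :
    completionTime s q₀ (n + 1) = completionTime s q₀ n + duration s q₀ n :=
  Finset.sum_range_succ _ _

/-- A path of service times is regular if all service times are positive and only finitely many
services are completed in a bounded time. On other paths the supremum in `numCompletions` need not
count the completions. -/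
structure IsRegular (s : Fin 2 → ℕ → ℝ) (q₀ : Fin 2) : Prop where
  duration_pos : ∀ n, 0 < duration s q₀ n
  tendsto_completionTime : Tendsto (completionTime s q₀) atTop atTop

namespace IsRegular

theorem monotone_completionTime (hs : IsRegular s q₀) : Monotone (completionTime s q₀) :=
  monotone_nat_of_le_succ fun n => by
    rw [completionTime_succ]
    exact le_add_of_nonneg_right (hs.duration_pos n).le

theorem completionTime_nonneg (hs : IsRegular s q₀) (n : ℕ) : 0 ≤ completionTime s q₀ n :=
  completionTime_zero.symm.trans_le (hs.monotone_completionTime n.zero_le)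

theorem completionTime_le_iff (hs : IsRegular s q₀) (ht : 0 ≤ t) :
    completionTime s q₀ n ≤ t ↔ n ≤ numCompletions s q₀ t := by
  obtain ⟨N, hN⟩ := (hs.tendsto_completionTime.eventually_gt_atTop t).exists
  have hbdd : BddAbove {n | completionTime s q₀ n ≤ t} :=
    ⟨N, fun n hn => (hs.monotone_completionTime.reflect_lt (hn.trans_lt hN)).le⟩
  have hnonempty : {n | completionTime s q₀ n ≤ t}.Nonempty := ⟨0, completionTime_zero.trans_le ht⟩
  exact ⟨fun hn => le_csSup hbdd hn, fun hn =>
    (hs.monotone_completionTime hn).trans (Nat.sSup_mem hnonempty hbdd)⟩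

theorem numCompletions_eq (hs : IsRegular s q₀) (ht : 0 ≤ t) (hle : completionTime s q₀ n ≤ t)
    (hlt : t < completionTime s q₀ (n + 1)) : numCompletions s q₀ t = n := by
  rw [← not_le, hs.completionTime_le_iff ht] at hlt
  rw [hs.completionTime_le_iff ht] at hle
  lia

theorem norm_agesAfter_le (hs : IsRegular s q₀) (n : ℕ) :
    ‖agesAfter s q₀ x₀ n‖ ≤ ‖x₀‖ + completionTime s q₀ n := by
  induction n with
  | zero => simp [agesAfter]
  | succ n ih =>
    calc ‖agesAfter s q₀ x₀ (n + 1)‖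
        ≤ ‖fun j => agesAfter s q₀ x₀ n j + duration s q₀ n‖ := norm_reset_le _ _
      _ ≤ ‖agesAfter s q₀ x₀ n‖ + duration s q₀ n := norm_add_const_le _ (hs.duration_pos n).le
      _ ≤ ‖x₀‖ + completionTime s q₀ (n + 1) := by
        rw [completionTime_succ]
        linarith

theorem norm_agesAt_le (hs : IsRegular s q₀) (ht : 0 ≤ t) :
    ‖agesAt s q₀ x₀ t‖ ≤ ‖x₀‖ + t := by
  have hlast := (hs.completionTime_le_iff ht).2 le_rfl
  calc ‖agesAt s q₀ x₀ t‖
      ≤ ‖agesAfter s q₀ x₀ (numCompletions s q₀ t)‖ +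
          (t - completionTime s q₀ (numCompletions s q₀ t)) :=
        norm_add_const_le _ (sub_nonneg.2 hlast)
    _ ≤ ‖x₀‖ + t := by linarith [hs.norm_agesAfter_le (x₀ := x₀) (numCompletions s q₀ t)]

end IsRegular

end Paths

section Forecast

variable {h : ℝ → Fin 2 → (Fin 3 → ℝ) → ℝ} {s : Fin 2 → ℕ → ℝ} {q₀ : Fin 2} {x₀ : Fin 3 → ℝ}
  {t : ℝ} {n : ℕ}

/-- Think of `h τ q x` as the mean of `h 0` at time `τ` for the system started in state `q` with
ages `x`. Then `forecast h s q₀ x₀ t n` is the forecast of `h 0` at time `t` that is made at the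
`n`-th completion, or the actual value of `h 0` at time `t` if that completion occurs after `t`. -/
noncomputable def forecast (h : ℝ → Fin 2 → (Fin 3 → ℝ) → ℝ) (s : Fin 2 → ℕ → ℝ) (q₀ : Fin 2)
    (x₀ : Fin 3 → ℝ) (t : ℝ) (n : ℕ) : ℝ :=
  if completionTime s q₀ n ≤ t then
    h (t - completionTime s q₀ n) (stateAfter q₀ n) (agesAfter s q₀ x₀ n)
  else h 0 (stateAt s q₀ t) (agesAt s q₀ x₀ t)

/-- The forecast with horizon `τ` from state `q` and ages `x`, revised at the end of the current
service if that lasts `u ≤ τ`, and at the horizon otherwise. -/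
noncomputable def revisedForecast (h : ℝ → Fin 2 → (Fin 3 → ℝ) → ℝ) (τ : ℝ) (q : Fin 2)
    (x : Fin 3 → ℝ) (u : ℝ) : ℝ :=
  if τ < u then h 0 q fun j => x j + τ else h (τ - u) (next q) (reset q fun j => x j + u)

/-- The change that the end of a service of duration `p.2` by server `q` makes to the forecast of
`h 0` at time `t`, if that service starts at time `p.1.1` with ages `p.1.2`. A service that starts
after time `t` changes nothing. -/
noncomputable def revision (h : ℝ → Fin 2 → (Fin 3 → ℝ) → ℝ) (t : ℝ) (q : Fin 2)
    (p : (ℝ × (Fin 3 → ℝ)) × ℝ) : ℝ :=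
  if p.1.1 ≤ t then revisedForecast h (t - p.1.1) q p.1.2 p.2 - h (t - p.1.1) q p.1.2 else 0

theorem forecast_zero (ht : 0 ≤ t) : forecast h s q₀ x₀ t 0 = h t q₀ x₀ := by
  simp [forecast, ht, stateAfter, agesAfter]

namespace IsRegular

theorem forecast_succ (hs : IsRegular s q₀) (ht : 0 ≤ t) :
    forecast h s q₀ x₀ t (n + 1) = forecast h s q₀ x₀ t n +
      revision h t (stateAfter q₀ n)
        ((completionTime s q₀ n, agesAfter s q₀ x₀ n), duration s q₀ n) := by
  rw [revision]
  split_ifs with hn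
  · rw [forecast.eq_def _ _ _ _ _ n, if_pos hn, add_sub_cancel, revisedForecast]
    by_cases hlt : t < completionTime s q₀ (n + 1)
    · have hlast := hs.numCompletions_eq ht hn hlt
      rw [forecast, if_neg hlt.not_ge,
        if_pos (sub_lt_iff_lt_add'.2 (completionTime_succ ▸ hlt)), stateAt, hlast]
      unfold agesAt
      rw [hlast]
    · rw [forecast, if_pos (not_lt.1 hlt), completionTime_succ, if_neg, sub_sub,
        stateAfter_succ, agesAfter]
      rwa [sub_lt_iff_lt_add', ← completionTime_succ]
  · have hn_succ : ¬completionTime s q₀ (n + 1) ≤ t :=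
      fun hle => hn ((hs.monotone_completionTime n.le_succ).trans hle)
    rw [forecast, forecast, if_neg hn, if_neg hn_succ, add_zero]

theorem tendsto_forecast (hs : IsRegular s q₀) (t : ℝ) :
    Tendsto (forecast h s q₀ x₀ t) atTop (𝓝 (h 0 (stateAt s q₀ t) (agesAt s q₀ x₀ t))) := by
  refine tendsto_const_nhds.congr' ?_
  filter_upwards [hs.tendsto_completionTime.eventually_gt_atTop t] with n hn
  rw [forecast, if_neg hn.not_ge]

theorem norm_forecast_le (hs : IsRegular s q₀) (ht : 0 ≤ t) {B : ℝ}
    (hB : ∀ q, ∀ τ ∈ Set.Icc 0 t, ∀ x, ‖x‖ ≤ ‖x₀‖ + t → ‖h τ q x‖ ≤ B) (n : ℕ) :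
    ‖forecast h s q₀ x₀ t n‖ ≤ B := by
  rw [forecast]
  split_ifs with hn
  · refine hB _ _ ⟨sub_nonneg.2 hn, sub_le_self t (hs.completionTime_nonneg n)⟩ _ ?_
    exact (hs.norm_agesAfter_le n).trans (by gcongr)
  · exact hB _ _ ⟨le_rfl, ht⟩ _ (hs.norm_agesAt_le ht)

end IsRegular

end Forecast

section ServiceTimes

variable {Ω : Type*} [MeasurableSpace Ω] {P : Measure Ω} {rate : Fin 2 → ℝ}
  {S : Fin 2 → ℕ → Ω → ℝ}

namespace IsServiceTimes

theorem isProbabilityMeasure (hS : IsServiceTimes P rate S) : IsProbabilityMeasure P :=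
  hS.indep.isProbabilityMeasure

theorem hasLaw_duration (hS : IsServiceTimes P rate S) (q₀ : Fin 2) (n : ℕ) :
    HasLaw (fun ω => duration (S · · ω) q₀ n) (expMeasure (rate (stateAfter q₀ n))) P :=
  hS.hasLaw _ _

theorem aemeasurable_duration (hS : IsServiceTimes P rate S) (q₀ : Fin 2) (n : ℕ) :
    AEMeasurable (fun ω => duration (S · · ω) q₀ n) P :=
  (hS.hasLaw_duration q₀ n).aemeasurable

theorem iIndepFun_duration (hS : IsServiceTimes P rate S) (q₀ : Fin 2) :
    iIndepFun (fun n ω => duration (S · · ω) q₀ n) P :=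
  hS.indep.precomp (injective_stateAfter_div_two q₀)

theorem tsum_measure_one_lt_duration (hS : IsServiceTimes P rate S) (hrate : ∀ q, 0 < rate q)
    (q₀ : Fin 2) : ∑' n, P {ω | 1 < duration (S · · ω) q₀ n} = ⊤ := by
  have hbound (n : ℕ) : ENNReal.ofReal (Real.exp (-(rate 0 + rate 1))) ≤
      P {ω | 1 < duration (S · · ω) q₀ n} := by
    have hq : 0 < rate (stateAfter q₀ n) := hrate _
    have := isProbabilityMeasure_expMeasure hq
    have hlaw := (hS.hasLaw_duration q₀ n).measure_eq (p := fun u => 1 < u) measurableSet_Ioi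
    have htail : P {ω | 1 < duration (S · · ω) q₀ n} =
        ENNReal.ofReal (Real.exp (-rate (stateAfter q₀ n))) := by
      rw [hlaw, ← mul_one (rate (stateAfter q₀ n)), ← expMeasure_real_Ioi hq zero_le_one,
        ofReal_measureReal, mul_one]
      rfl
    rw [htail]
    gcongr
    obtain hstate | hstate := eq_zero_or_eq_one (stateAfter q₀ n) <;> rw [hstate] <;>
      linarith [hrate 0, hrate 1]
  refine top_unique (le_of_eq_of_le ?_ (ENNReal.tsum_le_tsum hbound))
  exact (ENNReal.tsum_const_eq_top_of_ne_zero (by simp [Real.exp_pos])).symm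

theorem ae_isRegular (hS : IsServiceTimes P rate S) (hrate : ∀ q, 0 < rate q) (q₀ : Fin 2) :
    ∀ᵐ ω ∂P, IsRegular (S · · ω) q₀ := by
  have hpos : ∀ᵐ ω ∂P, ∀ n, 0 < duration (S · · ω) q₀ n := ae_all_iff.2 fun n =>
    ae_of_ae_map (hS.aemeasurable_duration q₀ n)
      ((hS.hasLaw_duration q₀ n).map_eq ▸ ae_pos_expMeasure (hrate _))
  filter_upwards [hpos, ae_frequently_lt_of_iIndepFun (hS.iIndepFun_duration q₀)
    (hS.aemeasurable_duration q₀) (hS.tsum_measure_one_lt_duration hrate q₀)] with ω hω hfreq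
  exact ⟨hω, tendsto_sum_atTop_of_frequently_lt (fun n => (hω n).le) one_pos hfreq⟩

end IsServiceTimes

theorem measurable_completionStep (q : Fin 2) :
    Measurable fun p : (ℝ × (Fin 3 → ℝ)) × ℝ => (p.1.1 + p.2, reset q fun j => p.1.2 j + p.2) :=
  (by fun_prop : Measurable fun p : (ℝ × (Fin 3 → ℝ)) × ℝ => p.1.1 + p.2).prodMk
    ((continuous_reset q).measurable.comp (by fun_prop))

namespace IsServiceTimes

theorem aemeasurable_completion (hS : IsServiceTimes P rate S) (q₀ : Fin 2) (x₀ : Fin 3 → ℝ)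
    (n : ℕ) :
    AEMeasurable (fun ω => (completionTime (S · · ω) q₀ n, agesAfter (S · · ω) q₀ x₀ n)) P :=
  aemeasurable_of_recursion
    (Z := fun n ω => (completionTime (S · · ω) q₀ n, agesAfter (S · · ω) q₀ x₀ n)) (z₀ := (0, x₀))
    (hS.aemeasurable_duration q₀) (fun n => measurable_completionStep (stateAfter q₀ n))
    (fun _ => congrArg (·, x₀) completionTime_zero) (fun _ _ => Prod.ext completionTime_succ rfl) n

theorem indepFun_completion_duration (hS : IsServiceTimes P rate S) (q₀ : Fin 2)
    (x₀ : Fin 3 → ℝ) (n : ℕ) :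
    IndepFun (fun ω => (completionTime (S · · ω) q₀ n, agesAfter (S · · ω) q₀ x₀ n))
      (fun ω => duration (S · · ω) q₀ n) P :=
  indepFun_of_recursion
    (Z := fun n ω => (completionTime (S · · ω) q₀ n, agesAfter (S · · ω) q₀ x₀ n)) (z₀ := (0, x₀))
    (hS.iIndepFun_duration q₀) (hS.aemeasurable_duration q₀)
    (fun n => measurable_completionStep (stateAfter q₀ n))
    (fun _ => congrArg (·, x₀) completionTime_zero) (fun _ _ => Prod.ext completionTime_succ rfl) n

end IsServiceTimes

end ServiceTimes

section BackwardEquation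

/-- `h` solves the Kolmogorov backward equation
`∂h/∂τ = ∑ j, ∂h/∂xⱼ + rate q * (h τ (next q) (reset q x) - h τ q x)` of the system, in which `τ`
is the remaining time. The equation is stated along the characteristic lines of its transport
term, on which the ages grow at unit rate, so that no partial derivatives are needed. -/
structure IsBackwardSolution (rate : Fin 2 → ℝ) (h : ℝ → Fin 2 → (Fin 3 → ℝ) → ℝ) : Prop where
  continuous : ∀ q, Continuous fun p : ℝ × (Fin 3 → ℝ) => h p.1 q p.2
  hasDerivAt : ∀ τ q (x : Fin 3 → ℝ) u, HasDerivAt (fun u => h (τ - u) q fun j => x j + u)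
    (rate q * (h (τ - u) q (fun j => x j + u) -
      h (τ - u) (next q) (reset q fun j => x j + u))) u

namespace IsBackwardSolution

variable {rate : Fin 2 → ℝ} {h : ℝ → Fin 2 → (Fin 3 → ℝ) → ℝ}

theorem exists_norm_le (hh : IsBackwardSolution rate h) (t C : ℝ) :
    ∃ B, ∀ q, ∀ τ ∈ Set.Icc 0 t, ∀ x, ‖x‖ ≤ C → ‖h τ q x‖ ≤ B := by
  have hbound (q : Fin 2) : ∃ B, ∀ τ ∈ Set.Icc 0 t, ∀ x, ‖x‖ ≤ C → ‖h τ q x‖ ≤ B := by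
    obtain ⟨B, hB⟩ := (isCompact_Icc.prod (isCompact_closedBall 0 C)).exists_bound_of_continuousOn
      (hh.continuous q).continuousOn
    exact ⟨B, fun τ hτ x hx => hB (τ, x) ⟨hτ, mem_closedBall_zero_iff.2 hx⟩⟩
  choose B hB using hbound
  refine ⟨max (B 0) (B 1), Fin.forall_fin_two.2 ⟨fun τ hτ x hx => ?_, fun τ hτ x hx => ?_⟩⟩
  · exact (hB 0 τ hτ x hx).trans (le_max_left _ _)
  · exact (hB 1 τ hτ x hx).trans (le_max_right _ _)

theorem measurable_revision (hh : IsBackwardSolution rate h) (t : ℝ) (q : Fin 2) :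
    Measurable (revision h t q) := by
  have hmeas {τ : (ℝ × (Fin 3 → ℝ)) × ℝ → ℝ} {x : (ℝ × (Fin 3 → ℝ)) × ℝ → Fin 3 → ℝ}
      (hτ : Measurable τ) (hx : Measurable x) (q : Fin 2) : Measurable fun p => h (τ p) q (x p) :=
    (hh.continuous q).measurable.comp (hτ.prodMk hx)
  have hreset : Measurable fun p : (ℝ × (Fin 3 → ℝ)) × ℝ => reset q fun j => p.1.2 j + p.2 :=
    (continuous_reset q).measurable.comp (by fun_prop)
  refine Measurable.ite (measurableSet_le (by fun_prop) measurable_const) (.sub ?_ ?_)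
    measurable_const
  · exact Measurable.ite (measurableSet_lt (by fun_prop) (by fun_prop))
      (hmeas measurable_const (by fun_prop) q) (hmeas (by fun_prop) hreset (next q))
  · exact hmeas (by fun_prop) (by fun_prop) q

theorem integral_revision (hh : IsBackwardSolution rate h) {q : Fin 2} (hq : 0 < rate q) (t : ℝ)
    (z : ℝ × (Fin 3 → ℝ)) : ∫ u, revision h t q (z, u) ∂expMeasure (rate q) = 0 := by
  simp only [revision]
  split_ifs with hz
  · have hτ : 0 ≤ t - z.1 := sub_nonneg.2 hz
    generalize t - z.1 = τ at hτ ⊢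
    have hremaining : Continuous fun u => τ - u := by fun_prop
    have hages : Continuous fun u => reset q fun j => z.2 j + u :=
      (continuous_reset q).comp (by fun_prop)
    have hφ : Continuous fun u =>
        h (τ - u) (next q) (reset q fun j => z.2 j + u) - h τ q z.2 :=
      ((hh.continuous (next q)).comp (hremaining.prodMk hages)).sub continuous_const
    have hmean := integral_ite_lt_expMeasure hq hτ hφ
      (y := fun u => h (τ - u) q (fun j => z.2 j + u) - h τ q z.2) fun u =>
        ((hh.hasDerivAt τ q z.2 u).sub_const _).congr_deriv (by ring)
    simpa only [revisedForecast, ite_sub, sub_self, sub_zero, add_zero] using hmean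
  · exact integral_zero _ _

variable {Ω : Type*} [MeasurableSpace Ω] {P : Measure Ω} {S : Fin 2 → ℕ → Ω → ℝ} {t : ℝ}

theorem exists_ae_norm_forecast_le (hh : IsBackwardSolution rate h) (hrate : ∀ q, 0 < rate q)
    (hS : IsServiceTimes P rate S) (q₀ : Fin 2) (x₀ : Fin 3 → ℝ) (ht : 0 ≤ t) :
    ∃ B, ∀ n, ∀ᵐ ω ∂P, ‖forecast h (S · · ω) q₀ x₀ t n‖ ≤ B := by
  obtain ⟨B, hB⟩ := hh.exists_norm_le t (‖x₀‖ + t)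
  exact ⟨B, fun n => (hS.ae_isRegular hrate q₀).mono fun ω hω => hω.norm_forecast_le ht hB n⟩

theorem aestronglyMeasurable_revision (hh : IsBackwardSolution rate h)
    (hS : IsServiceTimes P rate S) (q₀ : Fin 2) (x₀ : Fin 3 → ℝ) (t : ℝ) (n : ℕ) :
    AEStronglyMeasurable (fun ω => revision h t (stateAfter q₀ n)
      ((completionTime (S · · ω) q₀ n, agesAfter (S · · ω) q₀ x₀ n), duration (S · · ω) q₀ n)) P :=
  ((hh.measurable_revision t (stateAfter q₀ n)).comp_aemeasurable
    ((hS.aemeasurable_completion q₀ x₀ n).prodMk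
      (hS.aemeasurable_duration q₀ n))).aestronglyMeasurable

theorem aestronglyMeasurable_forecast (hh : IsBackwardSolution rate h) (hrate : ∀ q, 0 < rate q)
    (hS : IsServiceTimes P rate S) (q₀ : Fin 2) (x₀ : Fin 3 → ℝ) (ht : 0 ≤ t) (n : ℕ) :
    AEStronglyMeasurable (fun ω => forecast h (S · · ω) q₀ x₀ t n) P := by
  induction n with
  | zero => simpa only [forecast_zero ht] using aestronglyMeasurable_const
  | succ n ih =>
    refine (ih.add (hh.aestronglyMeasurable_revision hS q₀ x₀ t n)).congr ?_
    exact (hS.ae_isRegular hrate q₀).mono fun ω hω => (hω.forecast_succ ht).symm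

theorem integrable_forecast (hh : IsBackwardSolution rate h) (hrate : ∀ q, 0 < rate q)
    (hS : IsServiceTimes P rate S) (q₀ : Fin 2) (x₀ : Fin 3 → ℝ) (ht : 0 ≤ t) (n : ℕ) :
    Integrable (fun ω => forecast h (S · · ω) q₀ x₀ t n) P := by
  have := hS.isProbabilityMeasure
  obtain ⟨B, hB⟩ := hh.exists_ae_norm_forecast_le hrate hS q₀ x₀ ht
  exact .of_bound (hh.aestronglyMeasurable_forecast hrate hS q₀ x₀ ht n) B (hB n)

theorem integral_forecast (hh : IsBackwardSolution rate h) (hrate : ∀ q, 0 < rate q)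
    (hS : IsServiceTimes P rate S) (q₀ : Fin 2) (x₀ : Fin 3 → ℝ) (ht : 0 ≤ t) (n : ℕ) :
    ∫ ω, forecast h (S · · ω) q₀ x₀ t n ∂P = h t q₀ x₀ := by
  have := hS.isProbabilityMeasure
  induction n with
  | zero => simp [forecast_zero ht]
  | succ n ih =>
    have hint := hh.integrable_forecast hrate hS q₀ x₀ ht
    have hsub : (fun ω => forecast h (S · · ω) q₀ x₀ t (n + 1) - forecast h (S · · ω) q₀ x₀ t n)
        =ᵐ[P] fun ω => revision h t (stateAfter q₀ n) ((completionTime (S · · ω) q₀ n,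
          agesAfter (S · · ω) q₀ x₀ n), duration (S · · ω) q₀ n) :=
      (hS.ae_isRegular hrate q₀).mono fun ω hω => sub_eq_of_eq_add' (hω.forecast_succ ht)
    have hrevision := integral_eq_zero_of_indepFun (hS.indepFun_completion_duration q₀ x₀ n)
      (hS.aemeasurable_completion q₀ x₀ n) (hS.aemeasurable_duration q₀ n)
      (hh.measurable_revision t (stateAfter q₀ n)) (((hint (n + 1)).sub (hint n)).congr hsub)
      fun z => (hS.hasLaw_duration q₀ n).map_eq ▸ hh.integral_revision (hrate _) t z
    rw [← integral_congr_ae hsub, integral_sub (hint (n + 1)) (hint n)] at hrevision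
    exact (sub_eq_zero.1 hrevision).trans ih

theorem integrable_comp_stateAt_agesAt (hh : IsBackwardSolution rate h) (hrate : ∀ q, 0 < rate q)
    (hS : IsServiceTimes P rate S) (q₀ : Fin 2) (x₀ : Fin 3 → ℝ) (ht : 0 ≤ t) :
    Integrable (fun ω => h 0 (stateAt (S · · ω) q₀ t) (agesAt (S · · ω) q₀ x₀ t)) P := by
  have := hS.isProbabilityMeasure
  have hreg := hS.ae_isRegular hrate q₀
  obtain ⟨B, hB⟩ := hh.exists_norm_le t (‖x₀‖ + t)
  refine .of_bound (aestronglyMeasurable_of_tendsto_ae atTop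
    (hh.aestronglyMeasurable_forecast hrate hS q₀ x₀ ht)
    (hreg.mono fun ω hω => hω.tendsto_forecast t)) B (hreg.mono fun ω hω => ?_)
  exact hB _ 0 ⟨le_rfl, ht⟩ _ (hω.norm_agesAt_le ht)

theorem integral_comp_stateAt_agesAt (hh : IsBackwardSolution rate h) (hrate : ∀ q, 0 < rate q)
    (hS : IsServiceTimes P rate S) (q₀ : Fin 2) (x₀ : Fin 3 → ℝ) (ht : 0 ≤ t) :
    ∫ ω, h 0 (stateAt (S · · ω) q₀ t) (agesAt (S · · ω) q₀ x₀ t) ∂P = h t q₀ x₀ := by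
  have := hS.isProbabilityMeasure
  obtain ⟨B, hB⟩ := hh.exists_ae_norm_forecast_le hrate hS q₀ x₀ ht
  have hlim := tendsto_integral_of_dominated_convergence (fun _ => B)
    (hh.aestronglyMeasurable_forecast hrate hS q₀ x₀ ht) (integrable_const B) hB
    ((hS.ae_isRegular hrate q₀).mono fun ω hω => hω.tendsto_forecast t)
  simp only [hh.integral_forecast hrate hS q₀ x₀ ht] at hlim
  exact tendsto_nhds_unique hlim tendsto_const_nhds

end IsBackwardSolution

end BackwardEquation

section DiscreteState

variable {rate : Fin 2 → ℝ}

/-- The stationary distribution of the discrete state: the fraction of time spent in a state is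
proportional to the mean service time of its busy server. -/
noncomputable def stationaryDistribution (rate : Fin 2 → ℝ) (q : Fin 2) : ℝ :=
  rate (next q) / (rate 0 + rate 1)

/-- The probability that the discrete state is `q'` after time `τ`, starting in state `q`. -/
noncomputable def stateProbability (rate : Fin 2 → ℝ) (q' : Fin 2) (τ : ℝ) (q : Fin 2) : ℝ :=
  stationaryDistribution rate q' +
    ((if q = q' then 1 else 0) - stationaryDistribution rate q') *
      Real.exp (-((rate 0 + rate 1) * τ))

@[simp]
theorem stationaryDistribution_zero :
    stationaryDistribution rate 0 = rate 1 / (rate 0 + rate 1) :=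
  rfl

@[simp]
theorem stationaryDistribution_one :
    stationaryDistribution rate 1 = rate 0 / (rate 0 + rate 1) :=
  rfl

theorem vecMul_generator_eq_zero_iff (π : Fin 2 → ℝ) :
    Matrix.vecMul π (generator rate) = 0 ↔ π 0 * rate 0 = π 1 * rate 1 := by
  simp only [funext_iff, Fin.forall_fin_two, Matrix.vecMul, dotProduct, generator, next,
    Fin.sum_univ_two, Pi.zero_apply, Fin.isValue, one_ne_zero, zero_ne_one, ↓reduceIte]
  refine ⟨fun hπ => ?_, fun hπ => ⟨?_, ?_⟩⟩ <;> linarith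

theorem isStationary_generator_iff (hrate : ∀ q, 0 < rate q) (π : Fin 2 → ℝ) :
    IsStationary (generator rate) π ↔ π = stationaryDistribution rate := by
  have h₀ := hrate 0
  have h₁ := hrate 1
  rw [IsStationary, vecMul_generator_eq_zero_iff, Fin.forall_fin_two, Fin.sum_univ_two]
  constructor
  · rintro ⟨-, hsum, hbalance⟩
    refine funext (Fin.forall_fin_two.2 ⟨?_, ?_⟩)
    · rw [stationaryDistribution_zero, eq_div_iff (by positivity)]
      linear_combination rate 1 * hsum + hbalance
    · rw [stationaryDistribution_one, eq_div_iff (by positivity)]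
      linear_combination rate 0 * hsum - hbalance
  · rintro rfl
    simp only [stationaryDistribution_zero, stationaryDistribution_one]
    have hsum : rate 1 / (rate 0 + rate 1) + rate 0 / (rate 0 + rate 1) = 1 := by
      field_simp
      ring
    exact ⟨⟨by positivity, by positivity⟩, hsum, by ring⟩

theorem isBackwardSolution_stateProbability (hrate : ∀ q, 0 < rate q) (q' : Fin 2) :
    IsBackwardSolution rate fun τ q _ => stateProbability rate q' τ q where
  continuous q := by
    simp only [stateProbability]
    fun_prop
  hasDerivAt τ q _ u := by
    have hΛ : rate 0 + rate 1 ≠ 0 := (add_pos (hrate 0) (hrate 1)).ne'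
    have hjump : rate q * ((if q = q' then 1 else 0) - if next q = q' then 1 else 0) =
        (rate 0 + rate 1) * ((if q = q' then 1 else 0) - stationaryDistribution rate q') := by
      rw [mul_sub (rate 0 + rate 1), stationaryDistribution, mul_div_cancel₀ _ hΛ]
      obtain rfl | rfl := eq_zero_or_eq_one q <;> obtain rfl | rfl := eq_zero_or_eq_one q' <;>
        simp [next]
    have hexp := ((((hasDerivAt_id u).const_sub τ).const_mul (rate 0 + rate 1)).neg.exp.const_mul
      ((if q = q' then 1 else 0) - stationaryDistribution rate q')).const_add
        (stationaryDistribution rate q')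
    refine hexp.congr_deriv ?_
    simp only [stateProbability, id_eq]
    linear_combination (-Real.exp (-((rate 0 + rate 1) * (τ - u)))) * hjump

theorem tendsto_stateProbability (hrate : ∀ q, 0 < rate q) (q' q : Fin 2) :
    Tendsto (fun τ => stateProbability rate q' τ q) atTop (𝓝 (stationaryDistribution rate q')) := by
  simpa using! ((tendsto_exp_neg_mul_atTop (add_pos (hrate 0) (hrate 1))).const_mul
    ((if q = q' then 1 else 0) - stationaryDistribution rate q')).const_add
      (stationaryDistribution rate q')

variable {Ω : Type*} [MeasurableSpace Ω] {P : Measure Ω} {S : Fin 2 → ℕ → Ω → ℝ}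

theorem measureReal_stateAt_eq (hrate : ∀ q, 0 < rate q) (hS : IsServiceTimes P rate S)
    (q₀ q' : Fin 2) {t : ℝ} (ht : 0 ≤ t) :
    P.real {ω | stateAt (S · · ω) q₀ t = q'} = stateProbability rate q' t q₀ := by
  have hh := isBackwardSolution_stateProbability hrate q'
  have hindicator (ω : Ω) : stateProbability rate q' 0 (stateAt (S · · ω) q₀ t) =
      {ω | stateAt (S · · ω) q₀ t = q'}.indicator 1 ω := by
    simp [stateProbability, Set.indicator_apply]
  have hint := hh.integrable_comp_stateAt_agesAt hrate hS q₀ 0 ht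
  have hmean := hh.integral_comp_stateAt_agesAt hrate hS q₀ 0 ht
  simp only [hindicator] at hint hmean
  have hnull := (aemeasurable_indicator_const_iff (1 : ℝ)).1 hint.aemeasurable
  rw [← hmean, integral_indicator₀ hnull]
  simp

theorem tendsto_measureReal_stateAt (hrate : ∀ q, 0 < rate q) (hS : IsServiceTimes P rate S)
    (q₀ q' : Fin 2) :
    Tendsto (fun t => P.real {ω | stateAt (S · · ω) q₀ t = q'}) atTop
      (𝓝 (stationaryDistribution rate q')) := by
  refine (tendsto_stateProbability hrate q' q₀).congr' ?_
  filter_upwards [eventually_ge_atTop 0] with t ht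
  exact (measureReal_stateAt_eq hrate hS q₀ q' ht).symm

theorem meanWorking_eq (π : Fin 2 → ℝ) (i : Fin 2) : meanWorking π i = π i := by
  have hnum (q i : Fin 2) : numWorking q i = if q = i then 1 else 0 := by
    revert q i
    decide
  simp [meanWorking, hnum]

theorem powerWeightedActivity_stationaryDistribution (hrate : ∀ q, 0 < rate q) (α : ℝ) :
    powerWeightedActivity (stationaryDistribution rate) (rate 0 / rate 1) α =
      ((rate 0 / rate 1) ^ α + rate 0 / rate 1) / (1 + rate 0 / rate 1) := by
  have h₀ := hrate 0
  have h₁ := hrate 1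
  rw [powerWeightedActivity, meanWorking_eq, meanWorking_eq, stationaryDistribution_zero,
    stationaryDistribution_one]
  field_simp
  ring

end DiscreteState

section MonitorAge

variable {rate : Fin 2 → ℝ}

/-- The probability of no delivery to the monitor within time `τ` if server 2 has just started. -/
noncomputable abbrev noDelivery₂ (rate : Fin 2 → ℝ) : ℝ → ℝ :=
  relaxation (rate 1) 1 fun _ => 0

/-- The probability of no delivery to the monitor within time `τ` if server 1 has just started. -/
noncomputable abbrev noDelivery₁ (rate : Fin 2 → ℝ) : ℝ → ℝ :=
  relaxation (rate 0) 1 (noDelivery₂ rate)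

/-- The probability of exactly one delivery to the monitor within time `τ` if server 2 has just
started. -/
noncomputable abbrev oneDelivery₂ (rate : Fin 2 → ℝ) : ℝ → ℝ :=
  relaxation (rate 1) 0 (noDelivery₁ rate)

/-- The probability of exactly one delivery to the monitor within time `τ` if server 1 has just
started. -/
noncomputable abbrev oneDelivery₁ (rate : Fin 2 → ℝ) : ℝ → ℝ :=
  relaxation (rate 0) 0 (oneDelivery₂ rate)

/-- The average age at the monitor. -/
noncomputable def averageAge (rate : Fin 2 → ℝ) : ℝ :=
  2 / rate 1 + 1 / rate 0 + rate 1 / (rate 0 * (rate 0 + rate 1))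

/-- The amount by which the mean of `growth₁` and `growth₂` under the stationary distribution falls
short of `averageAge` after time `τ`. The weights are such that its derivative is minus the mean of
`noDelivery₁ + oneDelivery₁` and `noDelivery₂ + oneDelivery₂` under the stationary distribution,
and the value of `averageAge` makes that mean vanish at time `0`. -/
noncomputable def deficit (rate : Fin 2 → ℝ) (τ : ℝ) : ℝ :=
  2 / rate 1 * noDelivery₂ rate τ +
    (1 / rate 0 + rate 1 / (rate 0 * (rate 0 + rate 1))) * noDelivery₁ rate τ +
    1 / rate 1 * oneDelivery₂ rate τ +
    rate 1 / (rate 0 * (rate 0 + rate 1)) * oneDelivery₁ rate τ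

/-- The difference `growth₂ - growth₁`. -/
noncomputable def gap (rate : Fin 2 → ℝ) : ℝ → ℝ :=
  relaxation (rate 0 + rate 1) 0 fun τ =>
    (noDelivery₂ rate τ + oneDelivery₂ rate τ - noDelivery₁ rate τ - oneDelivery₁ rate τ) /
      (rate 0 + rate 1)

/-- The mean age at the monitor after time `τ` if server 1 has just started and all initial ages
are `0`. -/
noncomputable def growth₁ (rate : Fin 2 → ℝ) (τ : ℝ) : ℝ :=
  averageAge rate - deficit rate τ - rate 0 / (rate 0 + rate 1) * gap rate τ

/-- The mean age at the monitor after time `τ` if server 2 has just started and all initial ages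
are `0`. -/
noncomputable def growth₂ (rate : Fin 2 → ℝ) (τ : ℝ) : ℝ :=
  averageAge rate - deficit rate τ + rate 1 / (rate 0 + rate 1) * gap rate τ

/-- The mean age at the monitor after time `τ`, starting in state `q` with ages `x`. The initial
age at the monitor counts if nothing has been delivered by then, and that of the update in service
if only that update has been delivered. -/
noncomputable def meanAge (rate : Fin 2 → ℝ) (τ : ℝ) : Fin 2 → (Fin 3 → ℝ) → ℝ
  | 0, x => noDelivery₁ rate τ * x 0 + oneDelivery₁ rate τ * x 1 + growth₁ rate τ
  | 1, x => noDelivery₂ rate τ * x 0 + oneDelivery₂ rate τ * x 2 + growth₂ rate τ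

theorem hasDerivAt_deficit (hrate : ∀ q, 0 < rate q) (τ : ℝ) :
    HasDerivAt (deficit rate)
      (-(rate 1 * (noDelivery₁ rate τ + oneDelivery₁ rate τ) +
        rate 0 * (noDelivery₂ rate τ + oneDelivery₂ rate τ)) / (rate 0 + rate 1)) τ := by
  have h₀ := hrate 0
  have h₁ := hrate 1
  refine ((((hasDerivAt_relaxation continuous_const τ).const_mul _).add
    ((hasDerivAt_relaxation (by fun_prop) τ).const_mul _)).add
    ((hasDerivAt_relaxation (by fun_prop) τ).const_mul _)).add
    ((hasDerivAt_relaxation (by fun_prop) τ).const_mul _) |>.congr_deriv ?_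
  field_simp
  ring

theorem hasDerivAt_gap (hrate : ∀ q, 0 < rate q) (τ : ℝ) :
    HasDerivAt (gap rate)
      (noDelivery₂ rate τ + oneDelivery₂ rate τ - noDelivery₁ rate τ - oneDelivery₁ rate τ -
        (rate 0 + rate 1) * gap rate τ) τ := by
  have hΛ : rate 0 + rate 1 ≠ 0 := (add_pos (hrate 0) (hrate 1)).ne'
  refine (hasDerivAt_relaxation (by fun_prop) τ).congr_deriv ?_
  rw [mul_sub, mul_div_cancel₀ _ hΛ, gap]

theorem hasDerivAt_growth₁ (hrate : ∀ q, 0 < rate q) (τ : ℝ) :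
    HasDerivAt (growth₁ rate) (noDelivery₁ rate τ + oneDelivery₁ rate τ +
      rate 0 * (growth₂ rate τ - growth₁ rate τ)) τ := by
  have h₀ := hrate 0
  have h₁ := hrate 1
  refine (((hasDerivAt_deficit hrate τ).const_sub (averageAge rate)).sub
    ((hasDerivAt_gap hrate τ).const_mul _)).congr_deriv ?_
  rw [growth₁, growth₂]
  field_simp
  ring

theorem hasDerivAt_growth₂ (hrate : ∀ q, 0 < rate q) (τ : ℝ) :
    HasDerivAt (growth₂ rate) (noDelivery₂ rate τ + oneDelivery₂ rate τ +
      rate 1 * (growth₁ rate τ - growth₂ rate τ)) τ := by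
  have h₀ := hrate 0
  have h₁ := hrate 1
  refine (((hasDerivAt_deficit hrate τ).const_sub (averageAge rate)).add
    ((hasDerivAt_gap hrate τ).const_mul _)).congr_deriv ?_
  rw [growth₁, growth₂]
  field_simp
  ring

theorem isBackwardSolution_meanAge (hrate : ∀ q, 0 < rate q) :
    IsBackwardSolution rate (meanAge rate) where
  continuous := by
    refine Fin.forall_fin_two.2 ⟨?_, ?_⟩ <;>
      simp only [meanAge, growth₁, growth₂, deficit, gap] <;> fun_prop
  hasDerivAt τ q x u := by
    have hage (j : Fin 3) : HasDerivAt (fun u => x j + u) 1 u := (hasDerivAt_id u).const_add (x j)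
    obtain rfl | rfl := eq_zero_or_eq_one q
    · refine (((((hasDerivAt_relaxation (by fun_prop) _).comp_const_sub τ u).mul (hage 0)).add
        (((hasDerivAt_relaxation (by fun_prop) _).comp_const_sub τ u).mul (hage 1))).add
        ((hasDerivAt_growth₁ hrate _).comp_const_sub τ u)).congr_deriv ?_
      simp only [meanAge, next, reset, ↓reduceIte, Matrix.cons_val_zero, Matrix.cons_val]
      ring
    · refine (((((hasDerivAt_relaxation (by fun_prop) _).comp_const_sub τ u).mul (hage 0)).add
        (((hasDerivAt_relaxation (by fun_prop) _).comp_const_sub τ u).mul (hage 2))).add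
        ((hasDerivAt_growth₂ hrate _).comp_const_sub τ u)).congr_deriv ?_
      simp only [meanAge, next, reset, one_ne_zero, ↓reduceIte, Matrix.cons_val_zero,
        Matrix.cons_val_one]
      ring

theorem meanAge_zero (q : Fin 2) (x : Fin 3 → ℝ) : meanAge rate 0 q x = x 0 := by
  obtain rfl | rfl := eq_zero_or_eq_one q <;>
    simp [meanAge, growth₁, growth₂, gap, deficit, averageAge, add_assoc]

theorem tendsto_meanAge (hrate : ∀ q, 0 < rate q) (q : Fin 2) (x : Fin 3 → ℝ) :
    Tendsto (fun τ => meanAge rate τ q x) atTop (𝓝 (averageAge rate)) := by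
  have hnone₂ : Tendsto (noDelivery₂ rate) atTop (𝓝 0) :=
    tendsto_relaxation (hrate 1) continuous_const tendsto_const_nhds
  have hnone₁ : Tendsto (noDelivery₁ rate) atTop (𝓝 0) :=
    tendsto_relaxation (hrate 0) (by fun_prop) hnone₂
  have hone₂ : Tendsto (oneDelivery₂ rate) atTop (𝓝 0) :=
    tendsto_relaxation (hrate 1) (by fun_prop) hnone₁
  have hone₁ : Tendsto (oneDelivery₁ rate) atTop (𝓝 0) :=
    tendsto_relaxation (hrate 0) (by fun_prop) hone₂
  have hgap : Tendsto (gap rate) atTop (𝓝 0) :=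
    tendsto_relaxation (add_pos (hrate 0) (hrate 1)) (by fun_prop) (by
      simpa using! (((hnone₂.add hone₂).sub hnone₁).sub hone₁).div_const (rate 0 + rate 1))
  have hdeficit : Tendsto (deficit rate) atTop (𝓝 0) := by
    simpa using! (((hnone₂.const_mul _).add (hnone₁.const_mul _)).add (hone₂.const_mul _)).add
      (hone₁.const_mul _)
  have hgrowth₁ : Tendsto (growth₁ rate) atTop (𝓝 (averageAge rate)) := by
    simpa using! (hdeficit.const_sub (averageAge rate)).sub (hgap.const_mul _)
  have hgrowth₂ : Tendsto (growth₂ rate) atTop (𝓝 (averageAge rate)) := by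
    simpa using! (hdeficit.const_sub (averageAge rate)).add (hgap.const_mul _)
  obtain rfl | rfl := eq_zero_or_eq_one q
  · simpa using! ((hnone₁.mul_const (x 0)).add (hone₁.mul_const (x 1))).add hgrowth₁
  · simpa using! ((hnone₂.mul_const (x 0)).add (hone₂.mul_const (x 2))).add hgrowth₂

variable {Ω : Type*} [MeasurableSpace Ω] {P : Measure Ω} {S : Fin 2 → ℕ → Ω → ℝ}

theorem integrable_monitorAge (hrate : ∀ q, 0 < rate q) (hS : IsServiceTimes P rate S)
    (q₀ : Fin 2) (x₀ : Fin 3 → ℝ) {t : ℝ} (ht : 0 ≤ t) :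
    Integrable (fun ω => monitorAge (S · · ω) q₀ x₀ t) P := by
  simpa only [meanAge_zero] using!
    (isBackwardSolution_meanAge hrate).integrable_comp_stateAt_agesAt hrate hS q₀ x₀ ht

theorem integral_monitorAge (hrate : ∀ q, 0 < rate q) (hS : IsServiceTimes P rate S)
    (q₀ : Fin 2) (x₀ : Fin 3 → ℝ) {t : ℝ} (ht : 0 ≤ t) :
    ∫ ω, monitorAge (S · · ω) q₀ x₀ t ∂P = meanAge rate t q₀ x₀ := by
  simpa only [meanAge_zero] using!
    (isBackwardSolution_meanAge hrate).integral_comp_stateAt_agesAt hrate hS q₀ x₀ ht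

theorem tendsto_integral_monitorAge (hrate : ∀ q, 0 < rate q) (hS : IsServiceTimes P rate S)
    (q₀ : Fin 2) (x₀ : Fin 3 → ℝ) :
    Tendsto (fun t => ∫ ω, monitorAge (S · · ω) q₀ x₀ t ∂P) atTop (𝓝 (averageAge rate)) := by
  refine (tendsto_meanAge hrate q₀ x₀).congr' ?_
  filter_upwards [eventually_ge_atTop 0] with t ht
  exact (integral_monitorAge hrate hS q₀ x₀ ht).symm

theorem averageAge_eq (hrate : ∀ q, 0 < rate q) :
    averageAge rate = 1 / rate 1 * (2 + 1 / (rate 0 / rate 1) +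
      1 / (rate 0 / rate 1 * (1 + rate 0 / rate 1))) := by
  have h₀ := hrate 0
  have h₁ := hrate 1
  rw [averageAge]
  field_simp
  ring

end MonitorAge

end SSS

theorem mainTheorem5 {Ω : Type*} [MeasurableSpace Ω] (P : Measure Ω) [IsProbabilityMeasure P]
    (μ₁ μ₂ ρ α : ℝ) (hμ₁ : 0 < μ₁) (hμ₂ : 0 < μ₂) (hρ : ρ = μ₁ / μ₂)
    (S : Fin 2 → ℕ → Ω → ℝ) (hS : SSS.IsServiceTimes P ![μ₁, μ₂] S)
    (q₀ : Fin 2) (x₀ : Fin 3 → ℝ) :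
    (∀ t : ℝ, 0 ≤ t →
      Integrable (fun ω => SSS.monitorAge (fun i k => S i k ω) q₀ x₀ t) P) ∧
    Tendsto (fun t : ℝ => ∫ ω, SSS.monitorAge (fun i k => S i k ω) q₀ x₀ t ∂P) atTop
      (𝓝 (1 / μ₂ * (2 + 1 / ρ + 1 / (ρ * (1 + ρ))))) ∧
    ∃ π : Fin 2 → ℝ,
      (∀ π' : Fin 2 → ℝ, SSS.IsStationary (SSS.generator ![μ₁, μ₂]) π' ↔ π' = π) ∧
      (∀ q : Fin 2, Tendsto
        (fun t : ℝ => P.real {ω | SSS.stateAt (fun i k => S i k ω) q₀ t = q}) atTop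
        (𝓝 (π q))) ∧
      SSS.powerWeightedActivity π ρ α = (ρ ^ α + ρ) / (1 + ρ) := by
  have hrate : ∀ q, 0 < ![μ₁, μ₂] q := Fin.forall_fin_two.2 ⟨hμ₁, hμ₂⟩
  subst hρ
  refine ⟨fun t => SSS.integrable_monitorAge hrate hS q₀ x₀, ?_,
    SSS.stationaryDistribution ![μ₁, μ₂], SSS.isStationary_generator_iff hrate,
    SSS.tendsto_measureReal_stateAt hrate hS q₀,
    SSS.powerWeightedActivity_stationaryDistribution hrate α⟩
  exact SSS.averageAge_eq hrate ▸ SSS.tendsto_integral_monitorAge hrate hS q₀ x₀
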